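/- Let $d\ge 1$, and let $\mathbf N$ be the space of locally finite counting measures on $\mathbb R^d$ (Borel measures that take values in $\mathbb N_0$ on bounded Borel sets), with the $\sigma$-algebra generated by the maps $\mu\mapsto\mu(B)$, $B$ Borel. Let $\Lambda$ be a random locally finite measure on $\mathbb R^d$ and let $C$ be a Cox process directed by $\Lambda$ on the same probability space, i.e. an $\mathbf N$-valued random element that, conditionally on $\Lambda$, is a Poisson process with intensity measure $\Lambda$: for disjoint bounded Borel sets $A_1,\dots,A_k$ the counts $C(A_1),\dots,C(A_k)$ are, conditionally on $\Lambda$, independent with $C(A_i)\sim\mathrm{Poisson}(\Lambda(A_i))$. Assume that $C$ is simple, i.e. almost surely $C(\{x\})\le 1$ for all $x\in\mathbb R^d$. Fix $r>0$ and $p:\mathbb N_0\to[0,1]$. Let $B(x,r)$ be the closed Euclidean ball and let $n_r(x;C)=C\big(B(x,r)\setminus\{x\}\big)$ be the number of points of $C$ within distance $r$ of $x$ other than $x$. Enumerate the points of $C$ measurably as $\xi_i$, $0\le i<C(\mathbb R^d)$, and let $U_0,U_1,\dots$ be mutually independent $\mathrm{Uniform}(0,1)$ marks, independent of $C$ and of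 the enumeration of its points. The thinned process $T_r(C)$ consists of those points $\xi_i$ of $C$ for which $U_i\le p\big(n_r(\xi_i;C)\big)$. Put $m_p(t)=\mathbb E[p(N_t)]$ with $N_t\sim\mathrm{Poisson}(t)$. Then the intensity measure $\alpha_{T_r(C)}(\cdot)=\mathbb E[T_r(C)(\cdot)]$ satisfies, for every bounded Borel set $B\subset\mathbb R^d$, $$\alpha_{T_r(C)}(B)=\mathbb E\left[\int_B m_p\big(\Lambda(B(x,r))\big)\,\Lambda(dx)\right],$$ as an identity in $[0,\infty]$. -/

import Mathlib

open MeasureTheory ProbabilityTheory Set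
open scoped ENNReal NNReal

/-- The Euclidean space `ℝ^d`. -/
abbrev RSpace (d : ℕ) : Type := EuclideanSpace ℝ (Fin d)

/-- Locally finite Borel measures on `ℝ^d` (finite on bounded sets), with the `σ`-algebra generated
by the evaluations `μ ↦ μ B`, `B` Borel. -/
abbrev LocFinMeasure (d : ℕ) : Type :=
  {μ : Measure (RSpace d) // ∀ B : Set (RSpace d), Bornology.IsBounded B → μ B < ∞}

/-- The canonical space `𝐍` of locally finite counting measures on `ℝ^d`: Borel measures with values
in `ℕ₀` on bounded Borel sets, with the `σ`-algebra generated by the evaluations. -/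
abbrev CountingMeasure (d : ℕ) : Type :=
  {μ : Measure (RSpace d) //
    ∀ B : Set (RSpace d), Bornology.IsBounded B → MeasurableSet B → ∃ n : ℕ, μ B = n}

/-- `n_r(x; X)`, the number of points of the configuration `X` in the closed ball of radius `r`
around `x`, other than `x` itself. -/
noncomputable def neighbourCount {d : ℕ} (r : ℝ) (x : RSpace d) (X : CountingMeasure d) : ℕ :=
  ⌊(X.1 (Metric.closedBall x r \ {x})).toReal⌋₊

/-- `X` is simple: almost surely no location carries more than one point. -/
def IsSimplePointProcess {d : ℕ} {Ω : Type*} [MeasurableSpace Ω] (P : Measure Ω)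
    (X : Ω → CountingMeasure d) : Prop :=
  ∀ᵐ ω ∂P, ∀ x : RSpace d, (X ω).1 {x} ≤ 1

/-- The intensity measure of a point process `X`, evaluated at `B`: `α_X(B) = E[X(B)]`. -/
noncomputable def intensity {d : ℕ} {Ω : Type*} [MeasurableSpace Ω] (P : Measure Ω)
    (X : Ω → CountingMeasure d) (B : Set (RSpace d)) : ℝ≥0∞ :=
  ∫⁻ ω, (X ω).1 B ∂P

/-- `C` is a Cox process directed by the random locally finite measure `Λ`: conditionally on `Λ`,
it is a Poisson point process with intensity measure `Λ`. That is, for disjoint bounded Borel sets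
`A i`, the counts `C (A i)` are, conditionally on `Λ`, independent with laws `Poisson (Λ (A i))`. -/
structure IsCoxProcess {d : ℕ} {Ω : Type*} [MeasurableSpace Ω] (P : Measure Ω)
    (Λ : Ω → LocFinMeasure d) (C : Ω → CountingMeasure d) : Prop where
  measurable_directing : Measurable Λ
  measurable : Measurable C
  conditional_law : ∀ (k : ℕ) (A : Fin k → Set (RSpace d)),
    (∀ i, MeasurableSet (A i)) → (∀ i, Bornology.IsBounded (A i)) →
    (∀ i j, i ≠ j → Disjoint (A i) (A j)) → ∀ n : Fin k → ℕ,
      P⟦{ω | ∀ i, (C ω).1 (A i) = n i} | MeasurableSpace.comap Λ inferInstance⟧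
        =ᵐ[P] fun ω => ∏ i, (poissonMeasure ((Λ ω).1 (A i)).toNNReal).real {n i}

/-- `ξ 0, ξ 1, …` is a measurable enumeration of the points of `X`: the points of `X ω` are
the `ξ i ω` with `i` less than the total number `X ω (ℝ^d) ∈ ℕ₀ ∪ {∞}` of points. -/
structure IsEnumeration {d : ℕ} {Ω : Type*} [MeasurableSpace Ω]
    (X : Ω → CountingMeasure d) (ξ : ℕ → Ω → RSpace d) : Prop where
  measurable : ∀ i, Measurable (ξ i)
  eq_sum : ∀ ω, (X ω).1 =
    Measure.sum fun i : ℕ => {ω | (i : ℝ≥0∞) < (X ω).1 univ}.indicator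
      (fun ω => Measure.dirac (ξ i ω)) ω

/-- Independent marking of the points of `X`, enumerated by `ξ`: the mark of the point `ξ i` is
`U i`, where the `U i` are mutually independent, uniformly distributed on `(0,1)`, and independent
of `X` (together with the enumeration of its points). -/
structure IsIndependentUniformMarking {d : ℕ} {Ω : Type*} [MeasurableSpace Ω] (P : Measure Ω)
    (X : Ω → CountingMeasure d) (ξ : ℕ → Ω → RSpace d) (U : ℕ → Ω → ℝ) : Prop where
  measurable : ∀ i, Measurable (U i)
  uniform : ∀ i, pdf.IsUniform (U i) (Ioo 0 1) P volume
  independent : iIndepFun U P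
  independent_points : IndepFun (fun ω => (X ω, fun i => ξ i ω)) (fun ω i => U i ω) P

/-- The event that the `i`-th point of `X` exists and is retained: `U i ≤ p (n_r(ξ i; X))`. -/
def retained {d : ℕ} {Ω : Type*} (r : ℝ) (p : ℕ → unitInterval)
    (X : Ω → CountingMeasure d) (ξ : ℕ → Ω → RSpace d) (U : ℕ → Ω → ℝ) (i : ℕ) : Set Ω :=
  {ω | (i : ℝ≥0∞) < (X ω).1 univ ∧ U i ω ≤ p (neighbourCount r (ξ i ω) (X ω))}

theorem IsEnumeration.thinning_isCounting {d : ℕ} {Ω : Type*} [MeasurableSpace Ω]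
    {X : Ω → CountingMeasure d} {ξ : ℕ → Ω → RSpace d} (hξ : IsEnumeration X ξ)
    (r : ℝ) (p : ℕ → unitInterval) (U : ℕ → Ω → ℝ) (ω : Ω) (B : Set (RSpace d))
    (hB : Bornology.IsBounded B) (hBm : MeasurableSet B) :
    ∃ n : ℕ, (Measure.sum fun i : ℕ => (retained r p X ξ U i).indicator
      (fun ω => Measure.dirac (ξ i ω)) ω) B = n := by
  classical
  obtain ⟨m, hm⟩ := (X ω).2 B hB hBm
  rw [hξ.eq_sum ω, Measure.sum_apply _ hBm] at hm
  rw [Measure.sum_apply _ hBm]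
  have hval : ∀ i : ℕ, ((retained r p X ξ U i).indicator
      (fun ω => Measure.dirac (ξ i ω)) ω) B
      = ((if ω ∈ retained r p X ξ U i ∧ ξ i ω ∈ B then 1 else 0 : ℕ) : ℝ≥0∞) := by
    intro i
    by_cases h1 : ω ∈ retained r p X ξ U i <;> by_cases h2 : ξ i ω ∈ B <;>
      simp [h1, h2, Measure.dirac_apply' _ hBm]
  have hle : ∀ i : ℕ, ((retained r p X ξ U i).indicator
      (fun ω => Measure.dirac (ξ i ω)) ω) B ≤
      ({ω | (i : ℝ≥0∞) < (X ω).1 univ}.indicator (fun ω => Measure.dirac (ξ i ω)) ω) B := by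
    intro i
    by_cases h1 : ω ∈ retained r p X ξ U i
    · have h2 : ω ∈ {ω | (i : ℝ≥0∞) < (X ω).1 univ} := h1.1
      rw [indicator_of_mem h1, indicator_of_mem h2]
    · simp [h1]
  have hfin : ∑' i : ℕ, ((retained r p X ξ U i).indicator
      (fun ω => Measure.dirac (ξ i ω)) ω) B ≠ ∞ :=
    ((ENNReal.tsum_le_tsum hle).trans_lt (hm ▸ ENNReal.natCast_lt_top m)).ne
  have hs := ENNReal.finite_const_le_of_tsum_ne_top hfin one_ne_zero
  refine ⟨∑ i ∈ hs.toFinset, if ω ∈ retained r p X ξ U i ∧ ξ i ω ∈ B then 1 else 0, ?_⟩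
  rw [tsum_eq_sum (s := hs.toFinset)]
  · push_cast
    refine Finset.sum_congr rfl fun i _ => ?_
    rw [hval i]
    push_cast
    rfl
  · intro i hi
    rw [hval i]
    by_cases h : ω ∈ retained r p X ξ U i ∧ ξ i ω ∈ B
    · refine absurd ?_ hi
      rw [Set.Finite.mem_toFinset, mem_ofPred_eq, hval i]
      simp [h]
    · simp [h]

/-- The neighbour-count dependent thinning `T_r(X)`: the point `ξ i` of `X` is retained if and only
if its mark satisfies `U i ≤ p (n_r(ξ i; X))`. -/
noncomputable def neighbourThinning {d : ℕ} {Ω : Type*} [MeasurableSpace Ω]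
    {X : Ω → CountingMeasure d} {ξ : ℕ → Ω → RSpace d} (hξ : IsEnumeration X ξ)
    (U : ℕ → Ω → ℝ) (r : ℝ) (p : ℕ → unitInterval) (ω : Ω) : CountingMeasure d :=
  ⟨Measure.sum fun i : ℕ => (retained r p X ξ U i).indicator
      (fun ω => Measure.dirac (ξ i ω)) ω, hξ.thinning_isCounting r p U ω⟩

/-- `T_r(X)` is a point process, that is, a random element of `𝐍`. -/
theorem measurable_neighbourThinning {d : ℕ} {Ω : Type*} [MeasurableSpace Ω]
    {X : Ω → CountingMeasure d} {ξ : ℕ → Ω → RSpace d} (hX : Measurable X)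
    (hξ : IsEnumeration X ξ) {U : ℕ → Ω → ℝ} (hU : ∀ i, Measurable (U i))
    (r : ℝ) (p : ℕ → unitInterval) : Measurable (neighbourThinning hξ U r p) := by
  have huniv : Measurable fun ω => (X ω).1 univ :=
    (Measure.measurable_coe MeasurableSet.univ).comp hX.subtype_val
  have halive : ∀ i : ℕ, MeasurableSet {ω | (i : ℝ≥0∞) < (X ω).1 univ} := fun i =>
    measurableSet_lt measurable_const huniv
  have hcount : ∀ i : ℕ, Measurable fun ω => neighbourCount r (ξ i ω) (X ω) := by
    intro i
    refine (Nat.measurable_floor (R := ℝ)).comp (Measurable.ennreal_toReal ?_)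
    have hball : ∀ x : RSpace d, MeasurableSet (Metric.closedBall x r \ {x}) := fun x =>
      Metric.isClosed_closedBall.measurableSet.diff (measurableSet_singleton x)
    have : (fun ω => (X ω).1 (Metric.closedBall (ξ i ω) r \ {ξ i ω})) = fun ω =>
        ∑' j : ℕ, ({ω | (j : ℝ≥0∞) < (X ω).1 univ} ∩
          ({ω | dist (ξ j ω) (ξ i ω) ≤ r} ∩ {ω | ξ j ω = ξ i ω}ᶜ)).indicator
            (fun _ => (1 : ℝ≥0∞)) ω := by
      funext ω
      conv_lhs => rw [hξ.eq_sum ω]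
      rw [Measure.sum_apply _ (hball _)]
      refine tsum_congr fun j => ?_
      by_cases h1 : ω ∈ {ω | (j : ℝ≥0∞) < (X ω).1 univ}
      · rw [indicator_of_mem h1, Measure.dirac_apply' _ (hball _)]
        have h2 : ω ∈ {ω | (j : ℝ≥0∞) < (X ω).1 univ} ∩
            ({ω | dist (ξ j ω) (ξ i ω) ≤ r} ∩ {ω | ξ j ω = ξ i ω}ᶜ) ↔
            ξ j ω ∈ Metric.closedBall (ξ i ω) r \ {ξ i ω} :=
          ⟨fun h => ⟨h.2.1, h.2.2⟩, fun h => ⟨h1, h.1, h.2⟩⟩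
        by_cases h3 : ξ j ω ∈ Metric.closedBall (ξ i ω) r \ {ξ i ω}
        · rw [indicator_of_mem h3, indicator_of_mem (h2.2 h3)]
          rfl
        · rw [indicator_of_notMem h3, indicator_of_notMem (fun h => h3 (h2.1 h))]
      · rw [indicator_of_notMem h1, indicator_of_notMem (fun h => h1 h.1)]
        rfl
    rw [this]
    refine Measurable.tsum fun j => measurable_const.indicator ?_
    exact (halive j).inter ((measurableSet_le ((hξ.measurable j).dist (hξ.measurable i))
      measurable_const).inter (measurableSet_eq_fun (hξ.measurable j) (hξ.measurable i)).compl)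
  have hret : ∀ i : ℕ, MeasurableSet (retained r p X ξ U i) := fun i =>
    (halive i).inter (measurableSet_le (hU i)
      ((measurable_from_nat (f := fun n => (p n : ℝ))).comp (hcount i)))
  refine Measurable.subtype_mk (Measure.measurable_of_measurable_coe _ fun B hB => ?_)
  simp only [Measure.sum_apply _ hB]
  refine Measurable.tsum fun i => ?_
  exact (Measure.measurable_coe hB).comp
    ((Measure.measurable_dirac.comp (hξ.measurable i)).indicator (hret i))

/-- `m_p(t) = E[p(N_t)]` with `N_t ∼ Poisson(t)`. -/
noncomputable def poissonMean (p : ℕ → unitInterval) (t : ℝ≥0) : ℝ :=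
  ∫ n, (p n : ℝ) ∂(poissonMeasure t)

open Filter Topology

/-! ### The Poisson distribution -/

/-! Integrating out the uniform marks (`intensity_neighbourThinning`) turns the intensity into `E
∫_B p(n_r(x; C)) C(dx)`. What remains is a Mecke-type formula, obtained here by discretisation.

Cut `B` into small cells `D`, and let the collar `A` be the set of points outside `D` within
distance `r` of `D`. Given `Λ`, the counts `C(D)` and `C(A)` are independent Poisson variables, so
`1{C(D) = 1} p(C(A)) C(D)` has conditional mean `exp(-Λ(D)) m_p(Λ(A)) Λ(D)`
(`setLIntegral_eq_one_mul`). Sums over cells are integrals of step functions against `C` and `Λ`. As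
the mesh tends to zero, the cell of `x` shrinks to `{x}` and its collar converges to the closed ball
without `x`. Dominated convergence then yields `IsCoxProcess.setLIntegral_isolated`, with factors
`1{C{x} = 1}` and `exp(-Λ{x})`.

Simplicity makes the first factor equal to 1 at every point of `C`. Taking `p = 1` then gives `E
Λ(B) = E ∫_B exp(-Λ{x}) Λ(dx)`, which forces `Λ{x} = 0` for `Λ`-almost every `x`; so the second
factor is 1 as well and the centre may be put back into the ball. Domination requires `E Λ(B)`
finite, so everything is done on events `G` of the σ-algebra of `Λ` on which `Λ(B)` is bounded. -/

theorem ofReal_poissonMean (p : ℕ → unitInterval) (t : ℝ≥0) :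
    ENNReal.ofReal (poissonMean p t) =
      ∑' n, ENNReal.ofReal (p n) * poissonMeasure t {n} := by
  have hint : Integrable (fun n => (p n : ℝ)) (poissonMeasure t) :=
    Integrable.of_bound (C := 1) Measurable.of_discrete.aestronglyMeasurable
      (Eventually.of_forall fun n => by
        rw [Real.norm_of_nonneg (p n).2.1]; exact (p n).2.2)
  rw [poissonMean, ofReal_integral_eq_lintegral_ofReal hint
    (Eventually.of_forall fun n => (p n).2.1), lintegral_countable']

/-- The size-biasing identity `(n + 1) P(n + 1) = t P(n)` reduces the mean to the total mass. -/
theorem tsum_natCast_mul_poissonMeasure (t : ℝ≥0) :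
    ∑' n : ℕ, (n : ℝ≥0∞) * poissonMeasure t {n} = t := by
  rw [tsum_eq_zero_add' ENNReal.summable]
  have h : ∀ n : ℕ, ((n + 1 : ℕ) : ℝ≥0∞) * poissonMeasure t {n + 1} =
      t * poissonMeasure t {n} := by
    intro n
    rw [poissonMeasure_singleton, poissonMeasure_singleton, ← ENNReal.ofReal_natCast,
      ← ENNReal.ofReal_mul (by positivity), ← ENNReal.ofReal_coe_nnreal,
      ← ENNReal.ofReal_mul (by positivity)]
    congr 1
    rw [Nat.factorial_succ]
    push_cast
    field_simp
    ring
  simp_rw [h]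
  have h1 : ∑' n : ℕ, poissonMeasure t {n} = 1 := by
    simpa using (lintegral_countable' (μ := poissonMeasure t) fun _ : ℕ => 1).symm
  rw [ENNReal.tsum_mul_left, h1]
  simp

/-- Near `t` the series is dominated termwise by the exponential series at `t + 1`. Continuity is
what lets `m_p(Λ(A))` follow the shrinking collars. -/
theorem continuous_poissonMean (p : ℕ → unitInterval) : Continuous (poissonMean p) := by
  have h : poissonMean p =
      fun t : ℝ≥0 => ∑' n : ℕ, (Real.exp (-t) * t ^ n / n.factorial) • (p n : ℝ) :=
    funext fun t => integral_poissonMeasure t _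
  rw [h, continuous_iff_continuousAt]
  intro t
  have hmem : Iic (t + 1) ∈ 𝓝 t := Iic_mem_nhds (lt_add_one t)
  refine ContinuousOn.continuousAt ?_ hmem
  refine continuousOn_tsum (u := fun n : ℕ => ((t + 1 : ℝ≥0) : ℝ) ^ n / n.factorial) ?_ ?_ ?_
  · intro n
    fun_prop
  · exact Real.summable_pow_div_factorial _
  · intro n s hs
    have hs' : (s : ℝ) ≤ ((t + 1 : ℝ≥0) : ℝ) := NNReal.coe_le_coe.2 hs
    have hp0 := (p n).2.1
    rw [Real.norm_of_nonneg (by positivity), smul_eq_mul]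
    calc Real.exp (-s) * s ^ n / n.factorial * p n
        ≤ 1 * ((t + 1 : ℝ≥0) : ℝ) ^ n / n.factorial * 1 := by
          gcongr
          · exact Real.exp_le_one_iff.2 (by simp)
          · exact (p n).2.2
      _ = _ := by ring

theorem poissonMean_le_one (p : ℕ → unitInterval) (t : ℝ≥0) : poissonMean p t ≤ 1 := by
  have h := integral_mono_of_nonneg (μ := poissonMeasure t) (f := fun n => (p n : ℝ))
    (g := fun _ => 1) (Eventually.of_forall fun n => (p n).2.1) (integrable_const _)
    (Eventually.of_forall fun n => (p n).2.2)
  simpa [poissonMean] using h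

/-! ### Partitions of `ℝ^d` into small cells -/

theorem exists_dist_denseSeq_lt (d n : ℕ) (x : RSpace d) :
    ∃ k, dist x (TopologicalSpace.denseSeq (RSpace d) k) < 1 / ((n : ℝ) + 1) :=
  (TopologicalSpace.denseRange_denseSeq (RSpace d)).exists_dist_lt x Nat.one_div_pos_of_nat

open Classical in
/-- The index of the cell containing `x` in a countable measurable partition of `ℝ^d` into sets of
diameter at most `2 / (n + 1)`. -/
noncomputable def cellIndex {d : ℕ} (n : ℕ) (x : RSpace d) : ℕ :=
  Nat.find (exists_dist_denseSeq_lt d n x)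

theorem measurable_cellIndex {d : ℕ} (n : ℕ) : Measurable (cellIndex (d := d) n) := by
  classical
  refine measurable_find _ fun k => ?_
  exact measurableSet_lt (measurable_id.dist measurable_const) measurable_const

theorem dist_le_of_cellIndex_eq {d n : ℕ} {x y : RSpace d} (h : cellIndex n y = cellIndex n x) :
    dist y x ≤ 2 / ((n : ℝ) + 1) := by
  classical
  have hx := Nat.find_spec (exists_dist_denseSeq_lt d n x)
  have hy := Nat.find_spec (exists_dist_denseSeq_lt d n y)
  change dist x (TopologicalSpace.denseSeq (RSpace d) (cellIndex n x)) < _ at hx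
  change dist y (TopologicalSpace.denseSeq (RSpace d) (cellIndex n y)) < _ at hy
  rw [h] at hy
  have := dist_triangle_right y x (TopologicalSpace.denseSeq (RSpace d) (cellIndex n x))
  have h2 : (2 : ℝ) / ((n : ℝ) + 1) = 1 / ((n : ℝ) + 1) + 1 / ((n : ℝ) + 1) := by ring
  linarith

/-- The trace on `B` of the `k`-th cell of the `n`-th partition. -/
def cell {d : ℕ} (B : Set (RSpace d)) (n k : ℕ) : Set (RSpace d) := B ∩ cellIndex n ⁻¹' {k}

/-- The points outside a cell that are within distance `r` of it. -/
def collar {d : ℕ} (r : ℝ) (B : Set (RSpace d)) (n k : ℕ) : Set (RSpace d) :=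
  Metric.cthickening r (cell B n k) \ cell B n k

section Cells

variable {d : ℕ} {r : ℝ} {B : Set (RSpace d)}

theorem measurableSet_cell (hB : MeasurableSet B) (n k : ℕ) : MeasurableSet (cell B n k) :=
  hB.inter (measurable_cellIndex n (measurableSet_singleton k))

theorem measurableSet_collar (hB : MeasurableSet B) (n k : ℕ) :
    MeasurableSet (collar r B n k) :=
  Metric.isClosed_cthickening.measurableSet.diff (measurableSet_cell hB n k)

theorem disjoint_cell_collar (n k : ℕ) : Disjoint (cell B n k) (collar r B n k) :=
  disjoint_sdiff_right

theorem cell_subset_closedBall (n : ℕ) (x : RSpace d) :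
    cell B n (cellIndex n x) ⊆ Metric.closedBall x (2 / ((n : ℝ) + 1)) :=
  fun _ hy => dist_le_of_cellIndex_eq hy.2

theorem isBounded_cell (n k : ℕ) : Bornology.IsBounded (cell B n k) := by
  rcases (cell B n k).eq_empty_or_nonempty with h | ⟨x, hx⟩
  · simp [h]
  · obtain rfl : cellIndex n x = k := hx.2
    exact Metric.isBounded_closedBall.subset (cell_subset_closedBall n x)

theorem isBounded_collar (n k : ℕ) : Bornology.IsBounded (collar r B n k) :=
  (isBounded_cell n k).cthickening.subset sdiff_subset

theorem collar_subset_closedBall (hr : 0 < r) (n : ℕ) (x : RSpace d) :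
    collar r B n (cellIndex n x) ⊆ Metric.closedBall x (r + 2 / ((n : ℝ) + 1)) := by
  rw [← cthickening_closedBall hr.le (by positivity)]
  exact sdiff_subset.trans (Metric.cthickening_subset_of_subset _ (cell_subset_closedBall n x))

theorem tendsto_two_div_add_one : Tendsto (fun n : ℕ => 2 / ((n : ℝ) + 1)) atTop (𝓝 0) := by
  simpa [div_eq_mul_inv] using (tendsto_one_div_add_atTop_nhds_zero_nat (𝕜 := ℝ)).const_mul 2

theorem two_div_add_one_le (n : ℕ) : 2 / ((n : ℝ) + 1) ≤ 2 :=
  div_le_self (by norm_num) (by linarith [n.cast_nonneg (α := ℝ)])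

theorem eventually_mem_cell_iff {x : RSpace d} (hx : x ∈ B) (y : RSpace d) :
    ∀ᶠ n in atTop, y ∈ cell B n (cellIndex n x) ↔ y ∈ ({x} : Set (RSpace d)) := by
  by_cases h : y = x
  · subst h
    exact Eventually.of_forall fun n => by simp [cell, hx]
  · filter_upwards [tendsto_two_div_add_one.eventually_lt_const (dist_pos.2 h)] with n hn
    simp only [mem_singleton_iff, h, iff_false]
    exact fun hy => (cell_subset_closedBall n x hy).not_gt hn

/-- Points at distance exactly `r` are kept because `x` itself lies in its cell; points farther away
are lost once the cell diameter is smaller than the excess distance. -/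
theorem eventually_mem_collar_iff (hr : 0 < r) {x : RSpace d} (hx : x ∈ B) (y : RSpace d) :
    ∀ᶠ n in atTop, y ∈ collar r B n (cellIndex n x) ↔ y ∈ Metric.closedBall x r \ {x} := by
  have hev : ∀ᶠ n : ℕ in atTop, dist y x ≤ r + 2 / ((n : ℝ) + 1) → dist y x ≤ r := by
    by_cases h : dist y x ≤ r
    · exact Eventually.of_forall fun _ _ => h
    · filter_upwards [tendsto_two_div_add_one.eventually_lt_const (sub_pos.2 (not_le.1 h))]
        with n hn hle
      linarith
  filter_upwards [eventually_mem_cell_iff hx y, eventually_mem_cell_iff hx x,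
    hev] with n hn hnx hd
  have hy : y ∈ Metric.cthickening r (cell B n (cellIndex n x)) ∨ ¬ dist y x ≤ r := by
    by_cases h : dist y x ≤ r
    · exact Or.inl (Metric.mem_cthickening_of_dist_le _ _ _ _ (hnx.2 rfl) h)
    · exact Or.inr h
  constructor
  · intro h
    refine ⟨?_, fun h' => h.2 (hn.2 h')⟩
    exact hd (collar_subset_closedBall hr n x h)
  · rintro ⟨h, h'⟩
    exact ⟨hy.resolve_right (not_not.2 h), fun h'' => h' (hn.1 h'')⟩

theorem tendsto_measure_cell {μ : Measure (RSpace d)}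
    (hμ : ∀ K : Set (RSpace d), Bornology.IsBounded K → μ K ≠ ∞) (hB : MeasurableSet B)
    {x : RSpace d} (hx : x ∈ B) :
    Tendsto (fun n => μ (cell B n (cellIndex n x))) atTop (𝓝 (μ {x})) :=
  tendsto_measure_of_tendsto_indicator (B := Metric.closedBall x 2) atTop
    (fun n => measurableSet_cell hB n _) Metric.isClosed_closedBall.measurableSet
    (hμ _ Metric.isBounded_closedBall)
    (Eventually.of_forall fun n => (cell_subset_closedBall n x).trans
      (Metric.closedBall_subset_closedBall (two_div_add_one_le n)))
    (eventually_mem_cell_iff hx)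

theorem tendsto_measure_collar {μ : Measure (RSpace d)}
    (hμ : ∀ K : Set (RSpace d), Bornology.IsBounded K → μ K ≠ ∞) (hB : MeasurableSet B)
    (hr : 0 < r) {x : RSpace d} (hx : x ∈ B) :
    Tendsto (fun n => μ (collar r B n (cellIndex n x))) atTop
      (𝓝 (μ (Metric.closedBall x r \ {x}))) :=
  tendsto_measure_of_tendsto_indicator (B := Metric.closedBall x (r + 2)) atTop
    (fun n => measurableSet_collar hB n _) Metric.isClosed_closedBall.measurableSet
    (hμ _ Metric.isBounded_closedBall)
    (Eventually.of_forall fun n => (collar_subset_closedBall hr n x).trans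
      (Metric.closedBall_subset_closedBall (by linarith [two_div_add_one_le n])))
    (eventually_mem_collar_iff hr hx)

/-- Rewriting a sum over cells as an integral over `x` allows limits in `n` to be taken pointwise in
`x`, although the cells change with `n`. -/
theorem setLIntegral_cellIndex (μ : Measure (RSpace d)) (n : ℕ)
    (g : ℕ → ℝ≥0∞) :
    ∫⁻ x in B, g (cellIndex n x) ∂μ = ∑' k, g k * μ (cell B n k) := by
  rw [← lintegral_map Measurable.of_discrete (measurable_cellIndex n), lintegral_countable']
  refine tsum_congr fun k => ?_
  rw [Measure.map_apply (measurable_cellIndex n) (measurableSet_singleton k),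
    Measure.restrict_apply (measurable_cellIndex n (measurableSet_singleton k)), inter_comm, cell]

end Cells

/-! ### Integer-valued counts and measurability of the neighbour count -/

section Counting

variable {d : ℕ} {r : ℝ} {B : Set (RSpace d)}

theorem CountingMeasure.ne_top (X : CountingMeasure d) (K : Set (RSpace d))
    (hK : Bornology.IsBounded K) : X.1 K ≠ ∞ := by
  -- `K` need not be Borel, so its closure is used instead.
  obtain ⟨n, hn⟩ := X.2 (closure K) hK.closure isClosed_closure.measurableSet
  exact ne_top_of_le_ne_top (hn ▸ ENNReal.natCast_ne_top n) (measure_mono subset_closure)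

theorem CountingMeasure.natCast_floor (X : CountingMeasure d) {K : Set (RSpace d)}
    (hK : Bornology.IsBounded K) (hKm : MeasurableSet K) :
    ((⌊(X.1 K).toReal⌋₊ : ℕ) : ℝ≥0∞) = X.1 K := by
  obtain ⟨n, hn⟩ := X.2 K hK hKm
  simp [hn]

theorem measurable_floor_apply {K : Set (RSpace d)} (hK : MeasurableSet K) :
    Measurable fun X : CountingMeasure d => ⌊(X.1 K).toReal⌋₊ :=
  Nat.measurable_floor.comp
    ((Measure.measurable_coe hK).comp measurable_subtype_coe).ennreal_toReal

/-- Convergent integers are eventually constant, so an arbitrary function `p` of the counts passes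
to the limit. -/
theorem eventually_floor_eq {ι : Type*} {l : Filter ι} (X : CountingMeasure d)
    {K : ι → Set (RSpace d)} {L : Set (RSpace d)}
    (hK : ∀ i, Bornology.IsBounded (K i)) (hKm : ∀ i, MeasurableSet (K i))
    (hL : Bornology.IsBounded L) (hLm : MeasurableSet L)
    (h : Tendsto (fun i => X.1 (K i)) l (𝓝 (X.1 L))) :
    ∀ᶠ i in l, ⌊(X.1 (K i)).toReal⌋₊ = ⌊(X.1 L).toReal⌋₊ := by
  have h' := (ENNReal.tendsto_toReal (X.ne_top L hL)).comp h
  have hcast : ∀ M : Set (RSpace d), Bornology.IsBounded M → MeasurableSet M →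
      (X.1 M).toReal = (⌊(X.1 M).toReal⌋₊ : ℝ) := fun M hM hMm => by
    conv_lhs => rw [← X.natCast_floor hM hMm]
    simp
  have h2 : Tendsto (fun i => ((⌊(X.1 (K i)).toReal⌋₊ : ℕ) : ℝ)) l
      (𝓝 ((⌊(X.1 L).toReal⌋₊ : ℕ) : ℝ)) := by
    rw [← hcast L hL hLm]
    exact h'.congr fun i => hcast _ (hK i) (hKm i)
  have h3 := Nat.isClosedEmbedding_coe_real.tendsto_nhds_iff.2 h2
  rwa [nhds_discrete, tendsto_pure] at h3

theorem eventually_floor_collar_eq (X : CountingMeasure d) (hB : MeasurableSet B) (hr : 0 < r)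
    {x : RSpace d} (hx : x ∈ B) :
    ∀ᶠ n in atTop, ⌊(X.1 (collar r B n (cellIndex n x))).toReal⌋₊ = neighbourCount r x X :=
  eventually_floor_eq X (fun _ => isBounded_collar _ _) (fun _ => measurableSet_collar hB _ _)
    (Metric.isBounded_closedBall.subset sdiff_subset)
    (Metric.isClosed_closedBall.measurableSet.diff (measurableSet_singleton x))
    (tendsto_measure_collar X.ne_top hB hr hx)

theorem eventually_floor_cell_eq (X : CountingMeasure d) (hB : MeasurableSet B)
    {x : RSpace d} (hx : x ∈ B) :
    ∀ᶠ n in atTop, ⌊(X.1 (cell B n (cellIndex n x))).toReal⌋₊ = ⌊(X.1 {x}).toReal⌋₊ :=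
  eventually_floor_eq X (fun _ => isBounded_cell _ _) (fun _ => measurableSet_cell hB _ _)
    Bornology.isBounded_singleton (measurableSet_singleton x)
    (tendsto_measure_cell X.ne_top hB hx)

/-- Joint measurability holds because the approximating collar counts depend on `x` only through a
countable cell index. -/
theorem measurable_neighbourCount (hr : 0 < r) :
    Measurable fun q : CountingMeasure d × RSpace d => neighbourCount r q.2 q.1 := by
  refine measurable_of_tendsto_metrizable
    (f := fun n q => ⌊(q.1.1 (collar r univ n (cellIndex n q.2))).toReal⌋₊) (fun n => ?_)
    (tendsto_pi_nhds.2 fun q => ?_)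
  · have h : ∀ k : ℕ, Measurable fun X : CountingMeasure d =>
        ⌊(X.1 (collar r univ n k)).toReal⌋₊ :=
      fun k => measurable_floor_apply (measurableSet_collar MeasurableSet.univ n k)
    have h' : Measurable fun q : CountingMeasure d × ℕ =>
        ⌊(q.1.1 (collar r univ n q.2)).toReal⌋₊ := by
      refine measurable_from_prod_countable_left fun k => ?_
      exact h k
    have h'' : Measurable fun q : CountingMeasure d × RSpace d => (q.1, cellIndex n q.2) :=
      measurable_fst.prodMk ((measurable_cellIndex n).comp measurable_snd)
    have h3 := h'.comp h''
    simpa only [Function.comp_def] using h3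
  · rw [nhds_discrete, tendsto_pure]
    exact eventually_floor_collar_eq q.1 MeasurableSet.univ hr (mem_univ q.2)

end Counting

/-! ### Conditional counts of a Cox process -/

theorem measurable_poissonMeasure_singleton (n : ℕ) :
    Measurable fun t : ℝ≥0 => poissonMeasure t {n} := by
  simp_rw [poissonMeasure_singleton]
  fun_prop

theorem tsum_poissonMeasure_singleton (t : ℝ≥0) : ∑' n : ℕ, poissonMeasure t {n} = 1 := by
  simpa using (lintegral_countable' (μ := poissonMeasure t) fun _ : ℕ => 1).symm

theorem poissonMeasure_singleton_one (t : ℝ≥0) :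
    poissonMeasure t {1} = ENNReal.ofReal (Real.exp (-t)) * t := by
  rw [poissonMeasure_singleton, ← ENNReal.ofReal_coe_nnreal, ← ENNReal.ofReal_mul (by positivity)]
  simp

theorem measurable_locFinMeasure_apply {d : ℕ} {A : Set (RSpace d)} (hA : MeasurableSet A) :
    Measurable fun μ : LocFinMeasure d => μ.1 A :=
  (Measure.measurable_coe hA).comp measurable_subtype_coe

namespace IsCoxProcess

variable {d : ℕ} {Ω : Type*} [MeasurableSpace Ω] {P : Measure Ω}
  {Λ : Ω → LocFinMeasure d} {C : Ω → CountingMeasure d}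

theorem measurable_directing_apply (hC : IsCoxProcess P Λ C) {A : Set (RSpace d)}
    (hA : MeasurableSet A) : Measurable fun ω => (Λ ω).1 A :=
  (measurable_locFinMeasure_apply hA).comp hC.measurable_directing

theorem measurable_apply (hC : IsCoxProcess P Λ C) {A : Set (RSpace d)}
    (hA : MeasurableSet A) : Measurable fun ω => (C ω).1 A :=
  (Measure.measurable_coe hA).comp hC.measurable.subtype_val

theorem measurable_floor (hC : IsCoxProcess P Λ C) {A : Set (RSpace d)}
    (hA : MeasurableSet A) : Measurable fun ω => ⌊((C ω).1 A).toReal⌋₊ :=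
  (measurable_floor_apply hA).comp hC.measurable

variable [IsProbabilityMeasure P]

/-- Integrating the conditional law over `G` replaces conditional expectations by `ℝ≥0∞`-valued
integrals, free of integrability conditions. -/
theorem measure_inter (hC : IsCoxProcess P Λ C) {G : Set Ω}
    (hG : MeasurableSet[MeasurableSpace.comap Λ inferInstance] G) {k : ℕ}
    {A : Fin k → Set (RSpace d)} (hA : ∀ i, MeasurableSet (A i))
    (hAb : ∀ i, Bornology.IsBounded (A i)) (hAd : ∀ i j, i ≠ j → Disjoint (A i) (A j))
    (n : Fin k → ℕ) :
    P ({ω | ∀ i, (C ω).1 (A i) = n i} ∩ G) =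
      ∫⁻ ω in G, ∏ i, poissonMeasure ((Λ ω).1 (A i)).toNNReal {n i} ∂P := by
  have hm := hC.measurable_directing.comap_le
  have hS : MeasurableSet {ω | ∀ i, (C ω).1 (A i) = n i} := by
    rw [ofPred_forall]
    exact MeasurableSet.iInter fun i =>
      hC.measurable_apply (hA i) (measurableSet_singleton (n i : ℝ≥0∞))
  have hlaw := hC.conditional_law k A hA hAb hAd n
  have hint := (integrable_condExp (μ := P) (m := MeasurableSpace.comap Λ inferInstance)
    (f := {ω | ∀ i, (C ω).1 (A i) = n i}.indicator fun _ => (1 : ℝ))).congr hlaw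
  have h1 := setIntegral_condExp hm
    ((integrable_const (1 : ℝ)).indicator hS : Integrable _ P) hG
  rw [setIntegral_congr_ae (hm G hG) (hlaw.mono fun ω h _ => h), integral_indicator_const _ hS,
    measureReal_restrict_apply hS, smul_eq_mul, mul_one] at h1
  rw [← ofReal_measureReal, ← h1, ofReal_integral_eq_lintegral_ofReal hint.integrableOn
    (Eventually.of_forall fun ω => Finset.prod_nonneg fun i _ => measureReal_nonneg)]
  refine lintegral_congr fun ω => ?_
  rw [ENNReal.ofReal_prod_of_nonneg fun i _ => measureReal_nonneg]
  exact Finset.prod_congr rfl fun i _ => ofReal_measureReal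

/-- The pair of counts takes values in the countable set `ℕ × ℕ`, so its law on `G` is determined by
its atoms, which `measure_inter` supplies. -/
theorem setLIntegral_counts (hC : IsCoxProcess P Λ C) {G : Set Ω}
    (hG : MeasurableSet[MeasurableSpace.comap Λ inferInstance] G) {D A : Set (RSpace d)}
    (hD : MeasurableSet D) (hA : MeasurableSet A) (hDb : Bornology.IsBounded D)
    (hAb : Bornology.IsBounded A) (hDA : Disjoint D A) (F : ℕ → ℕ → ℝ≥0∞) :
    ∫⁻ ω in G, F ⌊((C ω).1 D).toReal⌋₊ ⌊((C ω).1 A).toReal⌋₊ ∂P =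
      ∫⁻ ω in G, ∑' m, ∑' n, F m n * (poissonMeasure ((Λ ω).1 D).toNNReal {m} *
        poissonMeasure ((Λ ω).1 A).toNNReal {n}) ∂P := by
  have hmeas : Measurable fun ω => (⌊((C ω).1 D).toReal⌋₊, ⌊((C ω).1 A).toReal⌋₊) :=
    (hC.measurable_floor hD).prodMk (hC.measurable_floor hA)
  have hpois : ∀ {K : Set (RSpace d)}, MeasurableSet K → ∀ m : ℕ,
      Measurable fun ω => poissonMeasure ((Λ ω).1 K).toNNReal {m} := fun hK m =>
    (measurable_poissonMeasure_singleton m).comp (hC.measurable_directing_apply hK).ennreal_toNNReal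
  have hmeasure : ∀ m n : ℕ,
      (P.restrict G) ((fun ω => (⌊((C ω).1 D).toReal⌋₊, ⌊((C ω).1 A).toReal⌋₊)) ⁻¹' {(m, n)}) =
        ∫⁻ ω in G, poissonMeasure ((Λ ω).1 D).toNNReal {m} *
          poissonMeasure ((Λ ω).1 A).toNNReal {n} ∂P := by
    intro m n
    have h := hC.measure_inter hG (A := ![D, A]) (by simp [Fin.forall_fin_two, hD, hA])
      (by simp [Fin.forall_fin_two, hDb, hAb])
      (by simp [Fin.forall_fin_two, hDA, hDA.symm]) ![m, n]
    simp only [Fin.prod_univ_two, Fin.forall_fin_two, Matrix.cons_val_zero,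
      Matrix.cons_val_one] at h
    rw [Measure.restrict_apply (hmeas (measurableSet_singleton _)), ← h]
    congr 2
    ext ω
    simp only [mem_preimage, mem_singleton_iff, Prod.mk.injEq, mem_ofPred_eq]
    rw [← (C ω).natCast_floor hDb hD, ← (C ω).natCast_floor hAb hA]
    simp
  have h1 := lintegral_map (μ := P.restrict G)
    (f := fun q : ℕ × ℕ => F q.1 q.2) Measurable.of_discrete hmeas
  rw [← h1, lintegral_countable', ENNReal.tsum_prod']
  simp_rw [Measure.map_apply hmeas (measurableSet_singleton _), hmeasure]
  have hprod : ∀ m n : ℕ, Measurable fun ω => poissonMeasure ((Λ ω).1 D).toNNReal {m} *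
      poissonMeasure ((Λ ω).1 A).toNNReal {n} := fun m n => (hpois hD m).mul (hpois hA n)
  rw [lintegral_tsum fun m => (Measurable.tsum fun n => (hprod m n).const_mul _).aemeasurable]
  refine tsum_congr fun m => ?_
  rw [lintegral_tsum fun n => ((hprod m n).const_mul _).aemeasurable]
  exact tsum_congr fun n => (lintegral_const_mul _ (hprod m n)).symm

theorem setLIntegral_apply (hC : IsCoxProcess P Λ C) {G : Set Ω}
    (hG : MeasurableSet[MeasurableSpace.comap Λ inferInstance] G) {B : Set (RSpace d)}
    (hB : MeasurableSet B) (hBb : Bornology.IsBounded B) :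
    ∫⁻ ω in G, (C ω).1 B ∂P = ∫⁻ ω in G, (Λ ω).1 B ∂P := by
  -- With an empty second set, the second Poisson factor sums to 1 and only the mean of `C(B)`
  -- remains.
  have h := hC.setLIntegral_counts hG hB MeasurableSet.empty hBb Bornology.isBounded_empty
    (disjoint_empty B) fun m _ => m
  simp_rw [(C _).natCast_floor hBb hB] at h
  rw [h]
  refine lintegral_congr fun ω => ?_
  simp_rw [← mul_assoc, ENNReal.tsum_mul_left, tsum_poissonMeasure_singleton, mul_one]
  rw [tsum_natCast_mul_poissonMeasure, ENNReal.coe_toNNReal ((Λ ω).2 B hBb).ne]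

/-- Only the term `C(D) = 1` survives, with Poisson weight `exp(-t) t` at `t = Λ(D)`. The factor
`C(D)`, redundant beside the indicator, makes the sum over cells an integral against `C`. -/
theorem setLIntegral_eq_one_mul (hC : IsCoxProcess P Λ C) {G : Set Ω}
    (hG : MeasurableSet[MeasurableSpace.comap Λ inferInstance] G) {D A : Set (RSpace d)}
    (hD : MeasurableSet D) (hA : MeasurableSet A) (hDb : Bornology.IsBounded D)
    (hAb : Bornology.IsBounded A) (hDA : Disjoint D A) (p : ℕ → unitInterval) :
    ∫⁻ ω in G, (if ⌊((C ω).1 D).toReal⌋₊ = 1 then 1 else 0) *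
        ENNReal.ofReal (p ⌊((C ω).1 A).toReal⌋₊) * (C ω).1 D ∂P =
      ∫⁻ ω in G, ENNReal.ofReal (Real.exp (-((Λ ω).1 D).toNNReal)) *
        ENNReal.ofReal (poissonMean p ((Λ ω).1 A).toNNReal) * (Λ ω).1 D ∂P := by
  have h := hC.setLIntegral_counts hG hD hA hDb hAb hDA
    fun m n => (if m = 1 then 1 else 0) * ENNReal.ofReal (p n) * m
  simp_rw [(C _).natCast_floor hDb hD] at h
  rw [h]
  refine lintegral_congr fun ω => ?_
  rw [tsum_eq_single 1 fun m hm => by simp [hm], ofReal_poissonMean]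
  conv_rhs => rw [mul_right_comm, ← ENNReal.coe_toNNReal ((Λ ω).2 D hDb).ne,
    ENNReal.toNNReal_coe, ← poissonMeasure_singleton_one, ← ENNReal.tsum_mul_left]
  refine tsum_congr fun n => ?_
  simp only [if_true, one_mul, Nat.cast_one, mul_one]
  ring

end IsCoxProcess

/-! ### Refining the partition -/

section Limit

variable {d : ℕ} {Ω : Type*} [MeasurableSpace Ω] {P : Measure Ω} {B : Set (RSpace d)}

/-- Dominated convergence is applied twice: in `x` with bound 1, then in `ω` with bound `X ω B`. -/
theorem tendsto_setLIntegral_tsum_cell {X : Ω → Measure (RSpace d)}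
    (hX : ∀ K, MeasurableSet K → Measurable fun ω => X ω K) (hXB : ∀ ω, X ω B ≠ ∞)
    (hB : MeasurableSet B) {G : Set Ω} (hfin : ∫⁻ ω in G, X ω B ∂P ≠ ∞)
    {g : ℕ → Ω → ℕ → ℝ≥0∞} (hg : ∀ n k, Measurable fun ω => g n ω k)
    (hg1 : ∀ n ω k, g n ω k ≤ 1) {h : Ω → RSpace d → ℝ≥0∞}
    (hlim : ∀ ω, ∀ x ∈ B, Tendsto (fun n => g n ω (cellIndex n x)) atTop (𝓝 (h ω x))) :
    Tendsto (fun n => ∫⁻ ω in G, ∑' k, g n ω k * X ω (cell B n k) ∂P) atTop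
      (𝓝 (∫⁻ ω in G, ∫⁻ x in B, h ω x ∂(X ω) ∂P)) := by
  refine tendsto_lintegral_of_dominated_convergence (fun ω => X ω B)
    (fun n => Measurable.tsum fun k => (hg n k).mul (hX _ (measurableSet_cell hB n k)))
    (fun n => Eventually.of_forall fun ω => ?_) hfin (Eventually.of_forall fun ω => ?_)
  · simp only
    rw [← setLIntegral_cellIndex]
    calc ∫⁻ x in B, g n ω (cellIndex n x) ∂(X ω) ≤ ∫⁻ x in B, 1 ∂(X ω) :=
          lintegral_mono fun x => hg1 n ω _
      _ = X ω B := by simp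
  · simp_rw [← setLIntegral_cellIndex]
    refine tendsto_lintegral_of_dominated_convergence (fun _ => 1)
      (fun n => Measurable.of_discrete.comp (measurable_cellIndex n))
      (fun n => Eventually.of_forall fun x => hg1 n ω _) (by simpa using hXB ω)
      (ae_restrict_of_forall_mem hB (hlim ω))

end Limit

namespace IsCoxProcess

variable {d : ℕ} {Ω : Type*} [MeasurableSpace Ω] {P : Measure Ω} [IsProbabilityMeasure P]
  {Λ : Ω → LocFinMeasure d} {C : Ω → CountingMeasure d}

/-- This limit of the cell identities does not presuppose simplicity. The factors at `{x}` are kept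
so that the same formula can later rule out atoms of `Λ`. -/
theorem setLIntegral_isolated (hC : IsCoxProcess P Λ C) {G : Set Ω}
    (hG : MeasurableSet[MeasurableSpace.comap Λ inferInstance] G) {B : Set (RSpace d)}
    (hB : MeasurableSet B) (hBb : Bornology.IsBounded B)
    (hfin : ∫⁻ ω in G, (Λ ω).1 B ∂P ≠ ∞) {r : ℝ} (hr : 0 < r) (p : ℕ → unitInterval) :
    ∫⁻ ω in G, ∫⁻ x in B, (if ⌊((C ω).1 {x}).toReal⌋₊ = 1 then 1 else 0) *
        ENNReal.ofReal (p (neighbourCount r x (C ω))) ∂((C ω).1) ∂P =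
      ∫⁻ ω in G, ∫⁻ x in B, ENNReal.ofReal (Real.exp (-((Λ ω).1 {x}).toNNReal)) *
        ENNReal.ofReal (poissonMean p ((Λ ω).1 (Metric.closedBall x r \ {x})).toNNReal)
          ∂((Λ ω).1) ∂P := by
  have hΛ : ∀ ω, ∀ K : Set (RSpace d), Bornology.IsBounded K → (Λ ω).1 K ≠ ∞ :=
    fun ω K hK => ((Λ ω).2 K hK).ne
  have hp1 : ∀ n, ENNReal.ofReal (p n) ≤ 1 := fun n => ENNReal.ofReal_le_one.2 (p n).2.2
  have hmC : ∀ n k, Measurable fun ω => (if ⌊((C ω).1 (cell B n k)).toReal⌋₊ = 1 then 1 else 0) *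
      ENNReal.ofReal (p ⌊((C ω).1 (collar r B n k)).toReal⌋₊) := fun n k =>
    ((Measurable.of_discrete (f := fun m : ℕ => if m = 1 then (1 : ℝ≥0∞) else 0)).comp
      (hC.measurable_floor (measurableSet_cell hB n k))).mul
    ((Measurable.of_discrete (f := fun m : ℕ => ENNReal.ofReal (p m))).comp
      (hC.measurable_floor (measurableSet_collar hB n k)))
  have hmΛ : ∀ n k, Measurable fun ω =>
      ENNReal.ofReal (Real.exp (-((Λ ω).1 (cell B n k)).toNNReal)) *
        ENNReal.ofReal (poissonMean p ((Λ ω).1 (collar r B n k)).toNNReal) := fun n k => by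
    have h1 := (hC.measurable_directing_apply (measurableSet_cell hB n k)).ennreal_toNNReal
    have h2 := (hC.measurable_directing_apply
      (measurableSet_collar (r := r) hB n k)).ennreal_toNNReal
    have h3 := ((continuous_poissonMean p).measurable.comp h2).ennreal_ofReal
    exact (Real.measurable_exp.comp h1.coe_nnreal_real.neg).ennreal_ofReal.mul h3
  have limC := tendsto_setLIntegral_tsum_cell (X := fun ω => (C ω).1) (G := G) (P := P)
    (fun K hK => hC.measurable_apply hK) (fun ω => (C ω).ne_top B hBb) hB
    (by rwa [hC.setLIntegral_apply hG hB hBb]) hmC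
    (fun n ω k => mul_le_one' (by split_ifs <;> simp) (hp1 _))
    (h := fun ω x => (if ⌊((C ω).1 {x}).toReal⌋₊ = 1 then 1 else 0) *
        ENNReal.ofReal (p (neighbourCount r x (C ω)))) (fun ω x hx => by
      refine tendsto_const_nhds.congr' ?_
      filter_upwards [eventually_floor_collar_eq (C ω) hB hr hx,
        eventually_floor_cell_eq (C ω) hB hx] with n h1 h2
      rw [h1, h2])
  have limΛ := tendsto_setLIntegral_tsum_cell (X := fun ω => (Λ ω).1) (G := G) (P := P)
    (fun K hK => hC.measurable_directing_apply hK) (fun ω => hΛ ω B hBb) hB hfin hmΛ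
    (fun n ω k => mul_le_one' (ENNReal.ofReal_le_one.2 (Real.exp_le_one_iff.2 (by simp)))
      (ENNReal.ofReal_le_one.2 (poissonMean_le_one p _)))
    (h := fun ω x => ENNReal.ofReal (Real.exp (-((Λ ω).1 {x}).toNNReal)) *
        ENNReal.ofReal (poissonMean p ((Λ ω).1 (Metric.closedBall x r \ {x})).toNNReal))
    (fun ω x hx => by
      have h1 := (ENNReal.tendsto_toNNReal (hΛ ω _ Bornology.isBounded_singleton)).comp
        (tendsto_measure_cell (hΛ ω) hB hx)
      have h2 := (ENNReal.tendsto_toNNReal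
        (hΛ ω _ (Metric.isBounded_closedBall.subset sdiff_subset))).comp
        (tendsto_measure_collar (hΛ ω) hB hr hx)
      refine ENNReal.Tendsto.mul
        (ENNReal.tendsto_ofReal ((Real.continuous_exp.tendsto _).comp
          ((NNReal.tendsto_coe.2 h1).neg)))
        (Or.inr ENNReal.ofReal_ne_top)
        (ENNReal.tendsto_ofReal (((continuous_poissonMean p).tendsto _).comp h2))
        (Or.inr ENNReal.ofReal_ne_top))
  -- At each mesh the two sums agree cell by cell, so their limits coincide.
  refine tendsto_nhds_unique limC (limΛ.congr fun n => ?_)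
  refine (lintegral_tsum fun k => ((hmΛ n k).mul
    (hC.measurable_directing_apply (measurableSet_cell hB n k))).aemeasurable).trans
    (Eq.trans ?_ (lintegral_tsum fun k => ((hmC n k).mul
      (hC.measurable_apply (measurableSet_cell hB n k))).aemeasurable).symm)
  exact tsum_congr fun k => (hC.setLIntegral_eq_one_mul hG (measurableSet_cell hB n k)
    (measurableSet_collar hB n k) (isBounded_cell n k) (isBounded_collar n k)
    (disjoint_cell_collar n k) p).symm

end IsCoxProcess

/-! ### Integration against an enumerated point process -/

namespace IsEnumeration

variable {d : ℕ} {Ω : Type*} [MeasurableSpace Ω] {X : Ω → CountingMeasure d}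
  {ξ : ℕ → Ω → RSpace d}

theorem setLIntegral_eq_tsum (hξ : IsEnumeration X ξ) (ω : Ω) {B : Set (RSpace d)}
    (hB : MeasurableSet B) (h : RSpace d → ℝ≥0∞) :
    ∫⁻ x in B, h x ∂((X ω).1) =
      ∑' i : ℕ, {ω | (i : ℝ≥0∞) < (X ω).1 univ}.indicator (fun ω => B.indicator h (ξ i ω)) ω := by
  rw [← lintegral_indicator hB]
  conv_lhs => rw [hξ.eq_sum ω]
  rw [lintegral_sum_measure]
  refine tsum_congr fun i => ?_
  by_cases hi : ω ∈ {ω | (i : ℝ≥0∞) < (X ω).1 univ}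
  · rw [indicator_of_mem hi, indicator_of_mem hi, lintegral_dirac]
  · rw [indicator_of_notMem hi, indicator_of_notMem hi, lintegral_zero_measure]

theorem one_le_singleton (hξ : IsEnumeration X ξ) {ω : Ω} {i : ℕ}
    (hi : (i : ℝ≥0∞) < (X ω).1 univ) : 1 ≤ (X ω).1 {ξ i ω} := by
  conv_rhs => rw [hξ.eq_sum ω]
  refine le_trans ?_ (Measure.le_sum_apply _ _ |> fun h => (ENNReal.le_tsum i).trans h)
  rw [indicator_of_mem (show ω ∈ {ω | (i : ℝ≥0∞) < (X ω).1 univ} from hi)]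
  simp

/-- Every enumerated point carries mass at least 1, hence exactly 1 by `hω`, so the indicator is 1
wherever the integral charges. -/
theorem setLIntegral_isolated (hξ : IsEnumeration X ξ) {ω : Ω}
    (hω : ∀ x : RSpace d, (X ω).1 {x} ≤ 1) {B : Set (RSpace d)} (hB : MeasurableSet B)
    (h : RSpace d → ℝ≥0∞) :
    ∫⁻ x in B, (if ⌊((X ω).1 {x}).toReal⌋₊ = 1 then 1 else 0) * h x ∂((X ω).1) =
      ∫⁻ x in B, h x ∂((X ω).1) := by
  rw [hξ.setLIntegral_eq_tsum ω hB, hξ.setLIntegral_eq_tsum ω hB]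
  refine tsum_congr fun i => ?_
  by_cases hi : ω ∈ {ω | (i : ℝ≥0∞) < (X ω).1 univ}
  · have h1 : (X ω).1 {ξ i ω} = 1 := le_antisymm (hω _) (hξ.one_le_singleton hi)
    rw [indicator_of_mem hi, indicator_of_mem hi]
    by_cases hB : ξ i ω ∈ B <;> simp [hB, h1]
  · rw [indicator_of_notMem hi, indicator_of_notMem hi]

end IsEnumeration

/-! ### Integrating out the marks -/

theorem volume_Ioo_inter_Iic (q : unitInterval) :
    volume (Ioo (0 : ℝ) 1 ∩ Iic (q : ℝ)) = ENNReal.ofReal q := by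
  -- Adding the null endpoint 1 makes the intersection `Ioc 0 q` uniformly in `q`, including `q =
  -- 1`.
  have h : (Ioo (0 : ℝ) 1 ∩ Iic (q : ℝ) : Set ℝ) =ᵐ[volume] (Ioc (0 : ℝ) 1 ∩ Iic (q : ℝ) : Set ℝ) :=
    Ioo_ae_eq_Ioc.inter (ae_eq_refl _)
  rw [measure_congr h, Ioc_inter_Iic, min_eq_right q.2.2, Real.volume_Ioc, sub_zero]

/-- By independence and Tonelli, the mark is integrated with `Y` frozen, and it falls below the
threshold `q(Y)` with probability `q(Y)`. -/
theorem lintegral_mul_indicator_le_of_uniform {Ω Z : Type*} [MeasurableSpace Ω]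
    [MeasurableSpace Z] {P : Measure Ω} [IsProbabilityMeasure P] {V : Ω → ℝ} (hV : Measurable V)
    (hVu : pdf.IsUniform V (Ioo 0 1) P volume) {Y : Ω → Z} (hY : Measurable Y)
    (hind : IndepFun Y V P) {a : Z → ℝ≥0∞} (ha : Measurable a) {q : Z → unitInterval}
    (hq : Measurable q) :
    ∫⁻ ω, a (Y ω) * {ω | V ω ≤ q (Y ω)}.indicator 1 ω ∂P =
      ∫⁻ ω, a (Y ω) * ENNReal.ofReal (q (Y ω)) ∂P := by
  have hset : MeasurableSet {w : Z × ℝ | w.2 ≤ q w.1} :=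
    measurableSet_le measurable_snd (measurable_subtype_coe.comp (hq.comp measurable_fst))
  have hF : Measurable fun w : Z × ℝ => a w.1 * {w : Z × ℝ | w.2 ≤ q w.1}.indicator 1 w :=
    (ha.comp measurable_fst).mul (measurable_one.indicator hset)
  have hVlaw : P.map V = volume.restrict (Ioo 0 1) := by
    rw [show P.map V = ProbabilityTheory.cond volume (Ioo 0 1) from hVu]
    simp [ProbabilityTheory.cond]
  have h1 := lintegral_map (μ := P) hF (hY.prodMk hV)
  rw [(indepFun_iff_map_prod_eq_prod_map_map hY.aemeasurable hV.aemeasurable).1 hind,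
    hVlaw, lintegral_prod _ hF.aemeasurable] at h1
  have h2 : ∀ z : Z, ∫⁻ u in Ioo (0 : ℝ) 1, a z * {w : Z × ℝ | w.2 ≤ q w.1}.indicator 1 (z, u) =
      a z * ENNReal.ofReal (q z) := by
    intro z
    have h3 : ∀ u : ℝ, {w : Z × ℝ | w.2 ≤ q w.1}.indicator (1 : Z × ℝ → ℝ≥0∞) (z, u) =
        (Iic (q z : ℝ)).indicator 1 u := fun u => rfl
    simp_rw [h3]
    rw [lintegral_const_mul _ (measurable_one.indicator measurableSet_Iic),
      lintegral_indicator_one measurableSet_Iic, Measure.restrict_apply measurableSet_Iic,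
      inter_comm, volume_Ioo_inter_Iic]
  simp_rw [h2] at h1
  have hg : Measurable fun z => a z * ENNReal.ofReal (q z) :=
    ha.mul (measurable_subtype_coe.comp hq).ennreal_ofReal
  exact h1.symm.trans (lintegral_map hg hY)

section Thinning

variable {d : ℕ}

theorem measurable_neighbourCount_eval {r : ℝ} (hr : 0 < r) (i : ℕ) :
    Measurable fun z : CountingMeasure d × (ℕ → RSpace d) => neighbourCount r (z.2 i) z.1 := by
  have h1 : Measurable fun z : CountingMeasure d × (ℕ → RSpace d) => (z.1, z.2 i) :=
    measurable_fst.prodMk ((measurable_pi_apply i).comp measurable_snd)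
  have h2 := (measurable_neighbourCount hr).comp h1
  simpa only [Function.comp_def] using h2

/-- The indicator that, in an enumerated configuration, the `i`-th point exists and is in `B`. -/
noncomputable def pointIndicator (B : Set (RSpace d)) (i : ℕ) :
    CountingMeasure d × (ℕ → RSpace d) → ℝ≥0∞ :=
  ({z | (i : ℝ≥0∞) < z.1.1 univ} ∩ {z | z.2 i ∈ B}).indicator 1

theorem measurable_pointIndicator {B : Set (RSpace d)} (hB : MeasurableSet B) (i : ℕ) :
    Measurable (pointIndicator B i) :=
  measurable_one.indicator ((measurableSet_lt measurable_const
    ((Measure.measurable_coe MeasurableSet.univ).comp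
      (measurable_subtype_coe.comp measurable_fst))).inter
    (((measurable_pi_apply i).comp measurable_snd) hB))

variable {Ω : Type*} [MeasurableSpace Ω] {X : Ω → CountingMeasure d} {ξ : ℕ → Ω → RSpace d}

theorem IsEnumeration.setLIntegral_eq_tsum_pointIndicator (hξ : IsEnumeration X ξ) (ω : Ω)
    {B : Set (RSpace d)} (hB : MeasurableSet B) (h : RSpace d → ℝ≥0∞) :
    ∫⁻ x in B, h x ∂((X ω).1) =
      ∑' i : ℕ, pointIndicator B i (X ω, fun i => ξ i ω) * h (ξ i ω) := by
  rw [hξ.setLIntegral_eq_tsum ω hB]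
  refine tsum_congr fun i => ?_
  by_cases h1 : (i : ℝ≥0∞) < (X ω).1 univ <;> by_cases h3 : ξ i ω ∈ B <;>
  simp [pointIndicator, indicator, h1, h3]

theorem neighbourThinning_apply (hξ : IsEnumeration X ξ) (U : ℕ → Ω → ℝ) (r : ℝ)
    (p : ℕ → unitInterval) (ω : Ω) {B : Set (RSpace d)} (hB : MeasurableSet B) :
    (neighbourThinning hξ U r p ω).1 B = ∑' i : ℕ, pointIndicator B i (X ω, fun i => ξ i ω) *
      {ω | U i ω ≤ p (neighbourCount r (ξ i ω) (X ω))}.indicator 1 ω := by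
  rw [neighbourThinning, Measure.sum_apply _ hB]
  refine tsum_congr fun i => ?_
  by_cases h1 : (i : ℝ≥0∞) < (X ω).1 univ <;>
  by_cases h2 : U i ω ≤ p (neighbourCount r (ξ i ω) (X ω)) <;>
  by_cases h3 : ξ i ω ∈ B <;>
  simp [pointIndicator, indicator, retained, h1, h2, h3, Measure.dirac_apply' _ hB]

/-- The existence, position and neighbour count of the `i`-th point are functions of the
configuration and its enumeration jointly, and this pair is independent of the mark `U i`. -/
theorem intensity_neighbourThinning {P : Measure Ω} [IsProbabilityMeasure P] (hX : Measurable X)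
    (hξ : IsEnumeration X ξ) {U : ℕ → Ω → ℝ} (hU : IsIndependentUniformMarking P X ξ U)
    {r : ℝ} (hr : 0 < r) (p : ℕ → unitInterval) {B : Set (RSpace d)} (hB : MeasurableSet B) :
    intensity P (neighbourThinning hξ U r p) B =
      ∫⁻ ω, ∫⁻ x in B, ENNReal.ofReal (p (neighbourCount r x (X ω))) ∂((X ω).1) ∂P := by
  have hY : Measurable fun ω => (X ω, fun i => ξ i ω) :=
    hX.prodMk (measurable_pi_lambda _ hξ.measurable)
  have hq : ∀ i : ℕ, Measurable fun z : CountingMeasure d × (ℕ → RSpace d) =>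
      p (neighbourCount r (z.2 i) z.1) := fun i =>
    (Measurable.of_discrete (f := p)).comp (measurable_neighbourCount_eval hr i)
  have hp : ∀ i : ℕ, Measurable fun ω => (p (neighbourCount r (ξ i ω) (X ω)) : ℝ) := fun i => by
    have h := measurable_subtype_coe.comp ((hq i).comp hY)
    simpa only [Function.comp_def] using h
  have ha : ∀ i : ℕ, Measurable fun ω => pointIndicator B i (X ω, fun i => ξ i ω) := fun i =>
    (measurable_pointIndicator hB i).comp hY
  have hind : ∀ i : ℕ, IndepFun (fun ω => (X ω, fun i => ξ i ω)) (U i) P := fun i =>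
    hU.independent_points.comp measurable_id (measurable_pi_apply i)
  have hR : ∀ ω, ∫⁻ x in B, ENNReal.ofReal (p (neighbourCount r x (X ω))) ∂((X ω).1) =
      ∑' i : ℕ, pointIndicator B i (X ω, fun i => ξ i ω) *
        ENNReal.ofReal (p (neighbourCount r (ξ i ω) (X ω))) :=
    fun ω => hξ.setLIntegral_eq_tsum_pointIndicator ω hB _
  rw [intensity, lintegral_congr fun ω => neighbourThinning_apply hξ U r p ω hB,
    lintegral_congr hR]
  refine (lintegral_tsum fun i => ((ha i).mul (measurable_one.indicator
    (measurableSet_le (hU.measurable i) (hp i)))).aemeasurable).trans (Eq.trans ?_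
      (lintegral_tsum fun i => ((ha i).mul (hp i).ennreal_ofReal).aemeasurable).symm)
  exact tsum_congr fun i => lintegral_mul_indicator_le_of_uniform (hU.measurable i) (hU.uniform i)
    hY (hind i) (measurable_pointIndicator hB i) (hq i)

end Thinning

/-! ### Simple Cox processes -/

namespace IsCoxProcess

variable {d : ℕ} {Ω : Type*} [MeasurableSpace Ω] {P : Measure Ω} [IsProbabilityMeasure P]
  {Λ : Ω → LocFinMeasure d} {C : Ω → CountingMeasure d}

/-- The directing measure of a simple Cox process has almost surely no atoms. -/
theorem ae_restrict_directing_singleton_eq_zero (hC : IsCoxProcess P Λ C)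
    (hsimple : IsSimplePointProcess P C) {ξ : ℕ → Ω → RSpace d} (hξ : IsEnumeration C ξ)
    {G : Set Ω} (hG : MeasurableSet[MeasurableSpace.comap Λ inferInstance] G)
    {B : Set (RSpace d)} (hB : MeasurableSet B) (hBb : Bornology.IsBounded B)
    (hfin : ∫⁻ ω in G, (Λ ω).1 B ∂P ≠ ∞) :
    ∀ᵐ ω ∂(P.restrict G), ∀ᵐ x ∂((Λ ω).1.restrict B), (Λ ω).1 {x} = 0 := by
  -- With `p = 1` the ball plays no role, so any radius serves.
  have h := hC.setLIntegral_isolated hG hB hBb hfin one_pos fun _ => 1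
  have hmean : ∀ t, poissonMean (fun _ => 1) t = 1 := fun t => by simp [poissonMean]
  simp_rw [hmean] at h
  simp only [Icc.coe_one, ENNReal.ofReal_one, mul_one] at h
  have hle1 : ∀ ω x, ENNReal.ofReal (Real.exp (-((Λ ω).1 {x}).toNNReal)) ≤ 1 := fun ω x =>
    ENNReal.ofReal_le_one.2 (Real.exp_le_one_iff.2 (by simp))
  have hle : ∀ ω, ∫⁻ x in B, ENNReal.ofReal (Real.exp (-((Λ ω).1 {x}).toNNReal)) ∂((Λ ω).1) ≤
      (Λ ω).1 B := fun ω => (lintegral_mono (hle1 ω)).trans (by simp)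
  have hleft : ∫⁻ ω in G, ∫⁻ x in B, (if ⌊((C ω).1 {x}).toReal⌋₊ = 1 then 1 else 0)
      ∂((C ω).1) ∂P = ∫⁻ ω in G, (Λ ω).1 B ∂P := by
    rw [← hC.setLIntegral_apply hG hB hBb]
    refine lintegral_congr_ae ((ae_restrict_of_ae hsimple).mono fun ω hω => ?_)
    simpa using hξ.setLIntegral_isolated hω hB fun _ => 1
  -- An inequality between functions with equal finite integrals is an almost sure equality; this is
  -- used first in `ω`, then in `x`, to get `exp(-Λ{x}) = 1`.
  have hae := ae_eq_of_ae_le_of_lintegral_le (μ := P.restrict G) (Eventually.of_forall hle)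
    (by rwa [← h, hleft]) (hC.measurable_directing_apply hB).aemeasurable
    (by rw [← h, hleft])
  filter_upwards [hae] with ω hω
  have hae' := ae_eq_of_ae_le_of_lintegral_le (μ := (Λ ω).1.restrict B) (g := fun _ => 1)
    (Eventually.of_forall (hle1 ω)) (by rw [hω]; exact ((Λ ω).2 B hBb).ne) aemeasurable_const
    (by simp [hω])
  filter_upwards [hae'] with x hx
  rw [ENNReal.ofReal_eq_one, Real.exp_eq_one_iff, neg_eq_zero, NNReal.coe_eq_zero,
    ENNReal.toNNReal_eq_zero_iff] at hx
  exact hx.resolve_right ((Λ ω).2 _ Bornology.isBounded_singleton).ne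

theorem setLIntegral_neighbourCount (hC : IsCoxProcess P Λ C)
    (hsimple : IsSimplePointProcess P C) {ξ : ℕ → Ω → RSpace d} (hξ : IsEnumeration C ξ)
    {G : Set Ω} (hG : MeasurableSet[MeasurableSpace.comap Λ inferInstance] G)
    {B : Set (RSpace d)} (hB : MeasurableSet B) (hBb : Bornology.IsBounded B)
    (hfin : ∫⁻ ω in G, (Λ ω).1 B ∂P ≠ ∞) {r : ℝ} (hr : 0 < r) (p : ℕ → unitInterval) :
    ∫⁻ ω in G, ∫⁻ x in B, ENNReal.ofReal (p (neighbourCount r x (C ω))) ∂((C ω).1) ∂P =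
      ∫⁻ ω in G, ∫⁻ x in B,
        ENNReal.ofReal (poissonMean p ((Λ ω).1 (Metric.closedBall x r)).toNNReal)
          ∂((Λ ω).1) ∂P := by
  have hleft := lintegral_congr_ae ((ae_restrict_of_ae (s := G) hsimple).mono fun ω hω =>
    hξ.setLIntegral_isolated hω hB fun x => ENNReal.ofReal (p (neighbourCount r x (C ω))))
  rw [← hleft, hC.setLIntegral_isolated hG hB hBb hfin hr p]
  refine lintegral_congr_ae ?_
  filter_upwards [hC.ae_restrict_directing_singleton_eq_zero hsimple hξ hG hB hBb hfin] with ω hω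
  refine lintegral_congr_ae (hω.mono fun x hx => ?_)
  simp only [hx, measure_sdiff_null hx]
  simp

end IsCoxProcess

/-! ### Localisation and conclusion -/

theorem mainTheorem12 {d : ℕ} (hd : 1 ≤ d)
    {Ω : Type*} [MeasurableSpace Ω] (P : Measure Ω) [IsProbabilityMeasure P]
    (Λ : Ω → LocFinMeasure d) (C : Ω → CountingMeasure d)
    (hC : IsCoxProcess P Λ C) (hsimple : IsSimplePointProcess P C)
    (ξ : ℕ → Ω → RSpace d) (hξ : IsEnumeration C ξ)
    (U : ℕ → Ω → ℝ) (hU : IsIndependentUniformMarking P C ξ U)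
    (r : ℝ) (hr : 0 < r) (p : ℕ → unitInterval)
    (B : Set (RSpace d)) (hB : MeasurableSet B) (hBb : Bornology.IsBounded B) :
    intensity P (neighbourThinning hξ U r p) B =
      ∫⁻ ω, ∫⁻ x in B,
        ENNReal.ofReal (poissonMean p ((Λ ω).1 (Metric.closedBall x r)).toNNReal)
          ∂((Λ ω).1) ∂P := by
  rw [intensity_neighbourThinning hC.measurable hξ hU hr p hB]
  -- `E Λ(B)` may be infinite. Since `Λ(B)` is finite pointwise, these `Λ`-measurable events
  -- partition `Ω`, and `Λ(B) ≤ K + 1` on the `K`-th one.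
  set G : ℕ → Set Ω := fun K => {ω | ⌊((Λ ω).1 B).toReal⌋₊ = K} with hGdef
  have hG : ∀ K, MeasurableSet[MeasurableSpace.comap Λ inferInstance] (G K) := fun K =>
    ⟨_, (Nat.measurable_floor.comp (measurable_locFinMeasure_apply hB).ennreal_toReal)
      (measurableSet_singleton K), rfl⟩
  have hGm : ∀ K, MeasurableSet (G K) := fun K => hC.measurable_directing.comap_le _ (hG K)
  have hdisj : Pairwise (Function.onFun Disjoint G) := fun K L hKL =>
    disjoint_left.2 fun ω (h1 : _ = K) (h2 : _ = L) => hKL (h1.symm.trans h2)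
  have hunion : ⋃ K, G K = univ := eq_univ_of_forall fun ω => mem_iUnion.2 ⟨_, rfl⟩
  have hfin : ∀ K, ∫⁻ ω in G K, (Λ ω).1 B ∂P ≠ ∞ := fun K => by
    refine ne_top_of_le_ne_top (b := ENNReal.ofReal (K + 1)) ENNReal.ofReal_ne_top ?_
    calc ∫⁻ ω in G K, (Λ ω).1 B ∂P ≤ ∫⁻ ω in G K, ENNReal.ofReal (K + 1) ∂P := by
          refine setLIntegral_mono measurable_const fun ω (hω : _ = K) => ?_
          rw [← ENNReal.ofReal_toReal ((Λ ω).2 B hBb).ne, ← hω]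
          exact ENNReal.ofReal_le_ofReal (Nat.lt_floor_add_one _).le
      _ ≤ ENNReal.ofReal (K + 1) := by
          rw [setLIntegral_const]
          exact mul_le_of_le_one_right' prob_le_one
  rw [← setLIntegral_univ, ← setLIntegral_univ (μ := P), ← hunion,
    lintegral_iUnion hGm hdisj, lintegral_iUnion hGm hdisj]
  exact tsum_congr fun K =>
    hC.setLIntegral_neighbourCount hsimple hξ (hG K) hB hBb (hfin K) hr p
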